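/- Let $\Gamma$ be a metric graph, given by a finite graph (loops and multiple edges allowed, no isolated vertices) with a positive finite length for each edge. For $p\in\Gamma$ let $T_p(\Gamma)$ be the set of outgoing tangent vectors at $p$. For $f\in \mathrm{PL}(\Gamma)$, the continuous piecewise linear functions with integer slopes, let $\mathrm{sl}_\eta(f)$ be the outgoing slope of $f$ along $\eta\in T_p(\Gamma)$, and put $\mathrm{div}(f)=\sum_p \mathrm{ord}_p(f)\cdot p$ with $\mathrm{ord}_p(f)=-\sum_{\eta\in T_p(\Gamma)}\mathrm{sl}_\eta(f)$. For a divisor $D$ let $R(D)=\{f\in\mathrm{PL}(\Gamma): \mathrm{div}(f)+D\ge 0\}$. A set of functions is tropically dependent if there are real constants $a_f$ such that at every point the minimum of the values $f+a_f$ is attained by at least two of the functions. A tropical submodule is a set of functions closed under tropical linear combinations $\min\{f_1+a_1,\dots,f_n+a_n\}$, $n\geq 1$, $a_i\in\mathbb R$. A tropical linear series of rank $r\ge 0$ is a pair $(D,\Sigma)$ with $\Sigma\subseteq R(D)$ a finitely generated tropical submodule such that (1) for every effective divisor $E$ of degree $r$ there is $f\in\Sigma$ with $\mathrm{div}(f)+D\ge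 E$, and (2) every set of $r+2$ functions in $\Sigma$ is tropically dependent. It is strongly recursive if, recursively, (3) for $r\ge1$, every set of $r$ functions in $\Sigma$ is contained in a strongly recursive tropical linear subseries $(D,\Sigma')$, $\Sigma'\subseteq\Sigma$, of rank $r-1$, and (4) if $S_1,S_2\subseteq\Sigma$ have sizes $s_1,s_2\le r$ with $s_1+s_2\ge r+2$, then there are strongly recursive tropical linear subseries $\Sigma_1\supseteq S_1$ and $\Sigma_2\supseteq S_2$ of ranks $s_1-1$ and $s_2-1$ such that $\Sigma_1\cap\Sigma_2$ contains a strongly recursive tropical linear series (with the same $D$) of rank $s_1+s_2-r-2$. Let $(D,\Sigma)$ be a strongly recursive tropical linear series of rank $r$ on $\Gamma$. Then for every tangent vector $\eta$ the set $\{\mathrm{sl}_\eta(f): f\in\Sigma\}$ has exactly $r+1$ elements $s_\eta[0]<\dots<s_\eta[r]$. For $p\in\Gamma$ and $f\in\Sigma$ let $\partial_p(f)\in\{0,\dots,r\}^{T_p(\Gamma)}$ be the vector with $\mathrm{sl}_\eta(f)=s_\eta[\partial_p(f)_\eta]$ for all $\eta\in T_p(\Gamma)$, and let $P_p=\{\partial_p(f):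 f\in\Sigma\}$ be the local array of $\Sigma$ at $p$. Then $P_p$ is totally rankable: for every $\mathbf x$, the number of distinct values of the $\eta$-coordinate on $\{\mathbf y\in P_p: \mathbf y\ge\mathbf x\}$ does not depend on $\eta\in T_p(\Gamma)$. Let $\rho_{P_p}(\mathbf x)$ be this number minus $1$, and define the local rank $\rho_p(f)=\rho_{P_p}(\partial_p(f))$. Moreover, for every effective divisor $E$ on $\Gamma$ with $\deg(E)=r$ there exists a single function $f\in\Sigma$ satisfying both $\mathrm{div}(f)+D\ge E$ and $\rho_p(f)\ge E(p)$ for all $p\in\Gamma$. -/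

import Mathlib

open scoped Topology

/-- A finite graph (loops and multiple edges allowed) with vertices `V` and edges `E`, together with
a positive finite length for every edge. Each edge is given an auxiliary orientation from `src` to
`tgt`, used only to parametrize it by the interval `[0, len e]`. -/
structure MetricGraph (V E : Type*) where
  src : E → V
  tgt : E → V
  len : E → ℝ
  len_pos : ∀ e, 0 < len e

namespace MetricGraph

variable {V E : Type*} (Γ : MetricGraph V E)

/-- The points of the metric graph: the vertices and the interior points of the edges. -/
inductive Point : Type _
  | vertex (v : V) : Point
  | interior (e : E) (t : Set.Ioo (0 : ℝ) (Γ.len e)) : Point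

open Classical in
/-- The parametrization of the edge `e` by `[0, len e]`. -/
noncomputable def edgePoint (e : E) (t : ℝ) : Γ.Point :=
  if h : t ∈ Set.Ioo (0 : ℝ) (Γ.len e) then .interior e ⟨t, h⟩
  else if t ≤ 0 then .vertex (Γ.src e) else .vertex (Γ.tgt e)

/-- An outgoing tangent vector at `p`: an edge `e`, a parameter `t` at which `e` passes through `p`,
and a direction (`fwd = true`: towards increasing parameters) in which `e` can be followed
from `t`. A loop at a vertex gives two tangent vectors there. -/
@[ext]
structure Tangent (p : Γ.Point) where
  e : E
  fwd : Bool
  t : ℝ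
  mem : t ∈ Set.Icc 0 (Γ.len e)
  room : if fwd then t < Γ.len e else 0 < t
  point_eq : Γ.edgePoint e t = p

variable {Γ}

/-- The point at distance `s` from `p` along the tangent vector `η` (for small `s ≥ 0`). -/
noncomputable def Tangent.ray {p : Γ.Point} (η : Γ.Tangent p) (s : ℝ) : Γ.Point :=
  Γ.edgePoint η.e (if η.fwd then η.t + s else η.t - s)

/-- A tangent vector is determined by its edge and its direction. -/
theorem Tangent.injective_edge_dir (p : Γ.Point) :
    Function.Injective (fun η : Γ.Tangent p => (η.e, η.fwd)) := by
  rintro ⟨e, b, t, ht, hr, hp⟩ ⟨e', b', t', ht', hr', hp'⟩ h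
  simp only [Prod.mk.injEq] at h
  obtain ⟨rfl, rfl⟩ := h
  have : t = t' := by
    have h := hp.trans hp'.symm
    unfold edgePoint at h
    have h1 := ht.1
    have h2 := ht.2
    have h3 := ht'.1
    have h4 := ht'.2
    split_ifs at h with i1 i2 i3 i4 i5 i6 i7 i8
    any_goals (injection h with _ h5; simpa using h5)
    all_goals
      clear h hp hp' ht ht'
      cases b <;> simp only [Set.mem_Ioo, Bool.false_eq_true, if_false, if_true] at * <;> grind
  subst this
  rfl

/-- Over a finite graph there are finitely many tangent vectors at every point. -/
instance [Finite E] (p : Γ.Point) : Finite (Γ.Tangent p) :=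
  Finite.of_injective _ (Tangent.injective_edge_dir p)

/-- `PL(Γ)`: the continuous piecewise linear functions with integer slopes. On every edge the
function is continuous, and affine with integer slope away from finitely many break points. -/
def IsPL (f : Γ.Point → ℝ) : Prop :=
  ∀ e, ContinuousOn (fun t => f (Γ.edgePoint e t)) (Set.Icc 0 (Γ.len e)) ∧
    ∃ B : Set ℝ, B.Finite ∧ ∀ a b, 0 ≤ a → a < b → b ≤ Γ.len e → Disjoint (Set.Ioo a b) B →
      ∃ (m : ℤ) (c : ℝ), ∀ t ∈ Set.Icc a b, f (Γ.edgePoint e t) = m * t + c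

/-- `f` has outgoing slope `m` along `η`. -/
def HasSlope {p : Γ.Point} (f : Γ.Point → ℝ) (η : Γ.Tangent p) (m : ℤ) : Prop :=
  ∀ᶠ s in 𝓝[>] (0 : ℝ), f (η.ray s) = f p + m * s

open Classical in
/-- The outgoing slope of `f` along `η`. -/
noncomputable def slope {p : Γ.Point} (f : Γ.Point → ℝ) (η : Γ.Tangent p) : ℤ :=
  if h : ∃ m, HasSlope f η m then h.choose else 0

theorem HasSlope.unique {p : Γ.Point} {f : Γ.Point → ℝ} {η : Γ.Tangent p} {m n : ℤ}
    (hm : HasSlope f η m) (hn : HasSlope f η n) : m = n := by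
  obtain ⟨s, ⟨h1, h2⟩, hs⟩ := ((hm.and hn).and self_mem_nhdsWithin).exists
  have hs' : s ≠ 0 := ne_of_gt hs
  have h3 : (m : ℝ) * s = n * s := by linarith
  exact_mod_cast mul_right_cancel₀ hs' h3

theorem HasSlope.slope_eq {p : Γ.Point} {f : Γ.Point → ℝ} {η : Γ.Tangent p} {m : ℤ}
    (hm : HasSlope f η m) : slope f η = m := by
  have h : ∃ m, HasSlope f η m := ⟨m, hm⟩
  rw [slope, dif_pos h]
  exact h.choose_spec.unique hm

/-- A finite set of reals misses a small interval to the right of any point. -/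
theorem exists_gap_right {B : Set ℝ} (hB : B.Finite) {t l : ℝ} (htl : t < l) :
    ∃ b, t < b ∧ b ≤ l ∧ Disjoint (Set.Ioo t b) B := by
  have h : ∀ᶠ x in 𝓝[>] t, x ∉ B := by
    have : (B \ {t})ᶜ ∈ 𝓝 t := (hB.subset Set.sdiff_subset).isClosed.isOpen_compl.mem_nhds (by simp)
    filter_upwards [nhdsWithin_le_nhds this, self_mem_nhdsWithin] with x hx hxt hxB
    exact hx ⟨hxB, ne_of_gt hxt⟩
  obtain ⟨u, hu, hsub⟩ := mem_nhdsGT_iff_exists_Ioo_subset.1 h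
  refine ⟨min u l, lt_min hu htl, min_le_right _ _, Set.disjoint_left.2 fun x hx => ?_⟩
  exact hsub ⟨hx.1, hx.2.trans_le (min_le_left _ _)⟩

theorem exists_gap_left {B : Set ℝ} (hB : B.Finite) {t l : ℝ} (htl : l < t) :
    ∃ a, l ≤ a ∧ a < t ∧ Disjoint (Set.Ioo a t) B := by
  have h : ∀ᶠ x in 𝓝[<] t, x ∉ B := by
    have : (B \ {t})ᶜ ∈ 𝓝 t := (hB.subset Set.sdiff_subset).isClosed.isOpen_compl.mem_nhds (by simp)
    filter_upwards [nhdsWithin_le_nhds this, self_mem_nhdsWithin] with x hx hxt hxB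
    exact hx ⟨hxB, ne_of_lt hxt⟩
  obtain ⟨u, hu, hsub⟩ := mem_nhdsLT_iff_exists_Ioo_subset.1 h
  refine ⟨max u l, le_max_right _ _, max_lt hu htl, Set.disjoint_left.2 fun x hx => ?_⟩
  exact hsub ⟨(le_max_left _ _).trans_lt hx.1, hx.2⟩

/-- A function in `PL(Γ)` has its slope along every tangent vector. -/
theorem IsPL.hasSlope {f : Γ.Point → ℝ} (hf : IsPL f) {p : Γ.Point} (η : Γ.Tangent p) :
    HasSlope f η (slope f η) := by
  suffices h : ∃ m, HasSlope f η m by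
    obtain ⟨m, hm⟩ := h
    rwa [hm.slope_eq]
  obtain ⟨e, b, t, ht, hr, rfl⟩ := η
  obtain ⟨-, B, hB, hlin⟩ := hf e
  cases b
  · simp only [Bool.false_eq_true, if_false] at hr
    obtain ⟨a, h0, hat, hd⟩ := exists_gap_left hB hr
    obtain ⟨m, c, h⟩ := hlin a t h0 hat ht.2 hd
    refine ⟨-m, ?_⟩
    have : Set.Ioo (0 : ℝ) (t - a) ∈ 𝓝[>] (0 : ℝ) := Ioo_mem_nhdsGT (by linarith)
    filter_upwards [this] with s hs
    have h1 := h t ⟨hat.le, le_rfl⟩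
    have h2 := h (t - s) ⟨by linarith [hs.2], by linarith [hs.1]⟩
    simp only [Tangent.ray, Bool.false_eq_true, if_false]
    rw [h1, h2]
    push_cast
    ring
  · simp only [if_true] at hr
    obtain ⟨b, htb, hbl, hd⟩ := exists_gap_right hB hr
    obtain ⟨m, c, h⟩ := hlin t b ht.1 htb hbl hd
    refine ⟨m, ?_⟩
    have : Set.Ioo (0 : ℝ) (b - t) ∈ 𝓝[>] (0 : ℝ) := Ioo_mem_nhdsGT (by linarith)
    filter_upwards [this] with s hs
    have h1 := h t ⟨le_rfl, htb.le⟩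
    have h2 := h (t + s) ⟨by linarith [hs.1], by linarith [hs.2]⟩
    simp only [Tangent.ray, if_true]
    rw [h1, h2]
    ring

/-- The order of vanishing of `f` at `p`, i.e. the coefficient of `div(f)` at `p`. -/
noncomputable def ord (f : Γ.Point → ℝ) (p : Γ.Point) : ℤ :=
  -∑ᶠ η : Γ.Tangent p, slope f η

variable (Γ) in
/-- Divisors: finitely supported integral formal sums of points. -/
abbrev Divisor := Γ.Point →₀ ℤ

/-- The degree of a divisor. -/
noncomputable def deg (D : Γ.Divisor) : ℤ := D.sum fun _ n => n

/-- `div(f) + D ≥ A`. For `A` effective this is the Baker-Norine rank property of `f` for `A`. -/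
def DivAddGE (D : Γ.Divisor) (f : Γ.Point → ℝ) (A : Γ.Divisor) : Prop :=
  ∀ p, A p ≤ ord f p + D p

/-- The complete linear series `R(D)`. -/
def completeSeries (D : Γ.Divisor) : Set (Γ.Point → ℝ) :=
  {f | IsPL f ∧ DivAddGE D f 0}

/-- The tropical submodule generated by `G`: all tropical linear combinations
`min {f₁ + a₁, …, fₙ + aₙ}` with `n ≥ 1`, `fᵢ ∈ G` and `aᵢ ∈ ℝ`. -/
def tropicalSpan (G : Set (Γ.Point → ℝ)) : Set (Γ.Point → ℝ) :=
  {f | ∃ (T : Finset (Γ.Point → ℝ)) (hT : T.Nonempty) (a : (Γ.Point → ℝ) → ℝ),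
    (T : Set (Γ.Point → ℝ)) ⊆ G ∧ ∀ p, f p = T.inf' hT fun g => g p + a g}

/-- `M` is a finitely generated tropical submodule. -/
def IsFGTropical (M : Set (Γ.Point → ℝ)) : Prop :=
  ∃ G : Set (Γ.Point → ℝ), G.Finite ∧ M = tropicalSpan G

/-- A finite set of functions is tropically dependent: for suitable constants, the minimum of the
functions `f + a f` is attained at least twice at every point. -/
def TropicallyDependent (T : Finset (Γ.Point → ℝ)) : Prop :=
  ∃ a : (Γ.Point → ℝ) → ℝ, ∀ p, ∃ f ∈ T, ∃ g ∈ T, f ≠ g ∧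
    f p + a f = g p + a g ∧ ∀ h ∈ T, f p + a f ≤ h p + a h

/-- `(D, M)` is a tropical linear series of rank `r`. -/
structure IsTLS (D : Γ.Divisor) (r : ℕ) (M : Set (Γ.Point → ℝ)) : Prop where
  subset : M ⊆ completeSeries D
  fg : IsFGTropical M
  rank : ∀ A : Γ.Divisor, 0 ≤ A → deg A = r → ∃ f ∈ M, DivAddGE D f A
  dependent : ∀ T : Finset (Γ.Point → ℝ), (T : Set (Γ.Point → ℝ)) ⊆ M → T.card = r + 2 →
    TropicallyDependent T

/-- `(D, M)` is a strongly recursive tropical linear series of rank `r`. The conditions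
`s₁, s₂ ≤ r` and `r + 2 ≤ s₁ + s₂` force `s₁, s₂ ≥ 2`, so no subtraction below is truncated. -/
def IsStronglyRecursive (D : Γ.Divisor) (r : ℕ) (M : Set (Γ.Point → ℝ)) : Prop :=
  IsTLS D r M ∧
  (∀ _ : 1 ≤ r, ∀ T : Finset (Γ.Point → ℝ), (T : Set (Γ.Point → ℝ)) ⊆ M → T.card = r →
    ∃ M' ⊆ M, (T : Set (Γ.Point → ℝ)) ⊆ M' ∧ IsStronglyRecursive D (r - 1) M') ∧
  (∀ s₁ s₂ : ℕ, ∀ _ : s₁ ≤ r, ∀ _ : s₂ ≤ r, ∀ _ : r + 2 ≤ s₁ + s₂,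
    ∀ T₁ T₂ : Finset (Γ.Point → ℝ),
    (T₁ : Set (Γ.Point → ℝ)) ⊆ M → (T₂ : Set (Γ.Point → ℝ)) ⊆ M → T₁.card = s₁ → T₂.card = s₂ →
    ∃ M₁ ⊆ M, ∃ M₂ ⊆ M, ∃ M₃ ⊆ M₁ ∩ M₂,
      (T₁ : Set (Γ.Point → ℝ)) ⊆ M₁ ∧ (T₂ : Set (Γ.Point → ℝ)) ⊆ M₂ ∧
      IsStronglyRecursive D (s₁ - 1) M₁ ∧ IsStronglyRecursive D (s₂ - 1) M₂ ∧
      IsStronglyRecursive D (s₁ + s₂ - r - 2) M₃)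
termination_by r
decreasing_by all_goals omega

/-! ### Dot arrays -/

/-- The principal subarray `P[x]`. -/
def principal {ι : Type*} (P : Set (ι → ℕ)) (x : ι → ℕ) : Set (ι → ℕ) :=
  {y ∈ P | x ≤ y}

/-- The rank of `P` along the `i`-axis. -/
noncomputable def axisRank {ι : Type*} (P : Set (ι → ℕ)) (i : ι) : ℤ :=
  (((fun x => x i) '' P).ncard : ℤ) - 1

/-- `P` is rankable of rank `s`. -/
def HasRank {ι : Type*} (P : Set (ι → ℕ)) (s : ℤ) : Prop :=
  ∀ i, axisRank P i = s

/-- `P` is totally rankable: every principal subarray is rankable. -/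
def TotallyRankable {ι : Type*} (P : Set (ι → ℕ)) : Prop :=
  ∀ x, ∃ s, HasRank (principal P x) s

open Classical in
/-- The rank array `ρ_P` of a totally rankable array `P` (of dimension at least `1`). -/
noncomputable def rankArray {ι : Type*} (P : Set (ι → ℕ)) (x : ι → ℕ) : ℤ :=
  if h : ∃ s, HasRank (principal P x) s then h.choose else -1

theorem rankArray_eq {ι : Type*} [Nonempty ι] {P : Set (ι → ℕ)} {x : ι → ℕ} {s : ℤ}
    (h : HasRank (principal P x) s) : rankArray P x = s := by
  have h' : ∃ s, HasRank (principal P x) s := ⟨s, h⟩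
  rw [rankArray, dif_pos h', ← h (Classical.arbitrary ι), h'.choose_spec (Classical.arbitrary ι)]

/-! ### Local arrays and local rank -/

/-- The set of slopes along `η` of the functions in `M`. -/
def slopeSet (M : Set (Γ.Point → ℝ)) {p : Γ.Point} (η : Γ.Tangent p) : Set ℤ :=
  (fun f => slope f η) '' M

/-- The position `∂_p(f)`: if the slopes of `M` along `η` are `s[0] < s[1] < ⋯ < s[r]`, then its
coordinate at `η` is the index `j` with `slope f η = s[j]`, i.e. the number of smaller slopes. -/
noncomputable def position (M : Set (Γ.Point → ℝ)) (p : Γ.Point) (f : Γ.Point → ℝ) :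
    Γ.Tangent p → ℕ :=
  fun η => {s ∈ slopeSet M η | s < slope f η}.ncard

/-- If `s` lists the slopes of `M` along `η` increasingly, then `position M p f η` is the index of
the slope of `f` in this list. -/
theorem position_eq_iff {M : Set (Γ.Point → ℝ)} {p : Γ.Point} {f : Γ.Point → ℝ} (hf : f ∈ M)
    {η : Γ.Tangent p} {r : ℕ} {s : Fin (r + 1) → ℤ} (hs : StrictMono s)
    (hrange : Set.range s = slopeSet M η) (j : Fin (r + 1)) :
    position M p f η = j ↔ slope f η = s j := by
  obtain ⟨k, hk⟩ : slope f η ∈ Set.range s := hrange ▸ ⟨f, hf, rfl⟩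
  have h : {t ∈ slopeSet M η | t < slope f η} = s '' (Finset.Iio k : Set (Fin (r + 1))) := by
    ext t
    rw [← hrange, ← hk]
    constructor
    · rintro ⟨⟨i, rfl⟩, hi⟩
      exact ⟨i, by simpa using hs.lt_iff_lt.1 hi, rfl⟩
    · rintro ⟨i, hi, rfl⟩
      exact ⟨⟨i, rfl⟩, hs (by simpa using hi)⟩
  have h2 : position M p f η = k := by
    rw [position, h, Set.ncard_image_of_injective _ hs.injective, Set.ncard_coe_finset, Fin.card_Iio]
  rw [h2, ← hk, hs.injective.eq_iff, Fin.val_inj]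

/-- The local array of `M` at `p`. -/
def localArray (M : Set (Γ.Point → ℝ)) (p : Γ.Point) : Set (Γ.Tangent p → ℕ) :=
  position M p '' M

/-- The local rank `ρ_p(f)` of `f ∈ M` at `p`. -/
noncomputable def localRank (M : Set (Γ.Point → ℝ)) (p : Γ.Point) (f : Γ.Point → ℝ) : ℤ :=
  rankArray (localArray M p) (position M p f)

/-- The local rank property of `f` for the divisor `A`. -/
def LocalRankProperty (M : Set (Γ.Point → ℝ)) (f : Γ.Point → ℝ) (A : Γ.Divisor) : Prop :=
  ∀ p, A p ≤ localRank M p f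

end MetricGraph

/-!
A function of `M` whose divisor has `n` points on a short segment starting at `p` bends at each of
them. Written as a tropical linear combination of finitely many generators, it therefore uses
generators of `n + 1` different slopes along this segment. With `n = r`, and with tropical
dependence for the upper bound, this counts the slopes of `M`.

By recursivity, `k + 1` functions of `M` with different slopes along one tangent vector at `p` lie
in a subseries of rank `k`, and by tropical dependence the slopes of this subseries at `p` are no
smaller than the least of theirs. Since it has `k + 1` slopes along every other tangent vector, the
local arrays are totally rankable.

For the local rank, replace each point `p` of an effective divisor `A` of degree `r` by `A(p)`
points at distances `t, 2t, …` on one ray from `p`, and take a function `hₜ` of `M` with the rank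
property for this divisor. As `t` tends to `0`, the coefficients of `hₜ` accumulate at those of some
`f` in `M`, and the generators at which the minimum defining `hₜ` is attained near `p` attain the
minimum defining `f` at `p`. So `f` has at most the slopes of `hₜ` at `p`, and its slope on the ray
is smaller by at least `A(p)`, whence `ord_p(f) ≥ ord_p(hₜ) + A(p)`. The same generators have
`A(p) + 1` slopes along the ray, all of them in the principal subarray of `f`.
-/

namespace MetricGraph

variable {V E : Type*} {Γ : MetricGraph V E} {p : Γ.Point}

theorem edgePoint_of_mem {e : E} {t : ℝ} (h : t ∈ Set.Ioo 0 (Γ.len e)) :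
    Γ.edgePoint e t = .interior e ⟨t, h⟩ := by
  rw [edgePoint, dif_pos h]

theorem edgePoint_zero (e : E) : Γ.edgePoint e 0 = .vertex (Γ.src e) := by
  simp [edgePoint]

theorem edgePoint_len (e : E) : Γ.edgePoint e (Γ.len e) = .vertex (Γ.tgt e) := by
  simp [edgePoint, Γ.len_pos e]

theorem eq_of_edgePoint_eq_edgePoint {e e' : E} {t t' : ℝ} (ht : t ∈ Set.Ioo 0 (Γ.len e))
    (h : Γ.edgePoint e' t' = Γ.edgePoint e t) : e' = e ∧ t' = t := by
  rw [edgePoint_of_mem ht, edgePoint] at h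
  split_ifs at h
  injection h with he ht'
  subst he
  exact ⟨rfl, by simpa using ht'⟩

theorem exists_edgePoint_eq (hΓ : ∀ v : V, ∃ e : E, Γ.src e = v ∨ Γ.tgt e = v) (p : Γ.Point) :
    ∃ e, ∃ t ∈ Set.Icc 0 (Γ.len e), Γ.edgePoint e t = p := by
  cases p with
  | vertex v =>
    obtain ⟨e, rfl | rfl⟩ := hΓ v
    · exact ⟨e, 0, ⟨le_rfl, (Γ.len_pos e).le⟩, edgePoint_zero e⟩
    · exact ⟨e, Γ.len e, ⟨(Γ.len_pos e).le, le_rfl⟩, edgePoint_len e⟩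
  | interior e t => exact ⟨e, t, ⟨t.2.1.le, t.2.2.le⟩, edgePoint_of_mem t.2⟩

theorem nonempty_tangent (hΓ : ∀ v : V, ∃ e : E, Γ.src e = v ∨ Γ.tgt e = v) (p : Γ.Point) :
    Nonempty (Γ.Tangent p) := by
  obtain ⟨e, t, ht, hp⟩ := exists_edgePoint_eq hΓ p
  rcases ht.2.lt_or_eq with hlt | rfl
  · exact ⟨⟨e, true, t, ht, by simpa using hlt, hp⟩⟩
  · exact ⟨⟨e, false, _, ht, by simpa using Γ.len_pos e, hp⟩⟩

/-- The direction of a tangent vector as a sign: `1` towards increasing parameters of its edge, `-1`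
towards decreasing ones. -/
def Tangent.sign (η : Γ.Tangent p) : ℤ :=
  if η.fwd then 1 else -1

/-- The parameter, on the edge of `η`, of the point `η.ray s`. -/
def Tangent.param (η : Γ.Tangent p) (s : ℝ) : ℝ :=
  η.t + η.sign * s

theorem Tangent.sign_mul_sign (η : Γ.Tangent p) : η.sign * η.sign = 1 := by
  unfold Tangent.sign
  split_ifs <;> rfl

theorem Tangent.ray_eq (η : Γ.Tangent p) (s : ℝ) : η.ray s = Γ.edgePoint η.e (η.param s) := by
  unfold Tangent.ray Tangent.param Tangent.sign
  split_ifs <;> congr 1 <;> push_cast <;> ring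

@[simp]
theorem Tangent.ray_zero (η : Γ.Tangent p) : η.ray 0 = p := by
  simp [Tangent.ray, η.point_eq]

theorem Tangent.param_injective (η : Γ.Tangent p) : Function.Injective η.param := by
  have hsign : (η.sign : ℝ) ≠ 0 := by
    exact_mod_cast left_ne_zero_of_mul_eq_one η.sign_mul_sign
  exact fun s t h => mul_left_cancel₀ hsign (add_left_cancel h)

theorem Tangent.eventually_param_mem (η : Γ.Tangent p) :
    ∀ᶠ s in 𝓝[>] (0 : ℝ), η.param s ∈ Set.Ioo 0 (Γ.len η.e) := by
  obtain ⟨e, fwd, t, ht, hroom, -⟩ := η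
  cases fwd
  · filter_upwards [Ioo_mem_nhdsGT (show 0 < t by simpa using hroom)] with s hs
    simp only [param, sign, Set.mem_Ioo] at ht hs ⊢
    constructor <;> push_cast <;> linarith [hs.1, hs.2, ht.2]
  · filter_upwards [Ioo_mem_nhdsGT (show 0 < Γ.len e - t by simpa using hroom)] with s hs
    simp only [param, sign, Set.mem_Ioo] at ht hs ⊢
    constructor <;> push_cast <;> linarith [hs.1, hs.2, ht.1]

theorem Tangent.eventually_ray_ne (η : Γ.Tangent p) (q : Γ.Point) :
    ∀ᶠ s in 𝓝[>] (0 : ℝ), η.ray s ≠ q := by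
  by_cases hq : ∃ s₀ > 0, η.param s₀ ∈ Set.Ioo 0 (Γ.len η.e) ∧ η.ray s₀ = q
  · obtain ⟨s₀, hs₀, hmem, rfl⟩ := hq
    filter_upwards [Ioo_mem_nhdsGT hs₀] with s hs heq
    rw [η.ray_eq, η.ray_eq] at heq
    exact hs.2.ne (η.param_injective (eq_of_edgePoint_eq_edgePoint hmem heq).2)
  · filter_upwards [η.eventually_param_mem, self_mem_nhdsWithin] with s hmem hs heq
    exact hq ⟨s, hs, hmem, heq⟩

/-- The tangent vector in direction `fwd` at an interior point of an edge. -/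
def interiorTangent (e : E) {u : ℝ} (hu : u ∈ Set.Ioo 0 (Γ.len e)) (fwd : Bool) :
    Γ.Tangent (Γ.edgePoint e u) where
  e := e
  fwd := fwd
  t := u
  mem := ⟨hu.1.le, hu.2.le⟩
  room := by cases fwd <;> simp [hu.1, hu.2]
  point_eq := rfl

theorem interiorTangent_bijective (e : E) {u : ℝ} (hu : u ∈ Set.Ioo 0 (Γ.len e)) :
    Function.Bijective (interiorTangent e hu) := by
  refine ⟨fun _ _ h => congrArg Tangent.fwd h, fun η => ?_⟩
  obtain ⟨he, ht⟩ := eq_of_edgePoint_eq_edgePoint hu η.point_eq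
  exact ⟨η.fwd, Tangent.ext he.symm rfl ht.symm⟩

theorem ord_edgePoint_eq_zero {f : Γ.Point → ℝ} {e : E} {u : ℝ} {m : ℤ}
    (hu : u ∈ Set.Ioo 0 (Γ.len e))
    (hf : ∀ᶠ v in 𝓝 u, f (Γ.edgePoint e v) = f (Γ.edgePoint e u) + m * (v - u)) :
    ord f (Γ.edgePoint e u) = 0 := by
  have hslope (fwd : Bool) :
      slope f (interiorTangent e hu fwd) = (interiorTangent e hu fwd).sign * m := by
    have htendsto : Filter.Tendsto (interiorTangent e hu fwd).param (𝓝[>] 0) (𝓝 u) := by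
      refine (Continuous.tendsto' ?_ 0 u ?_).mono_left nhdsWithin_le_nhds
      · unfold Tangent.param
        fun_prop
      · simp [Tangent.param, interiorTangent]
    refine HasSlope.slope_eq ?_
    filter_upwards [htendsto.eventually hf] with s hs
    rw [Tangent.ray_eq]
    refine hs.trans ?_
    simp only [Tangent.param, interiorTangent]
    push_cast
    ring
  rw [ord, ← finsum_eq_of_bijective (f := fun b => slope f (interiorTangent e hu b)) _
    (interiorTangent_bijective e hu) (fun _ => rfl), finsum_eq_sum_of_fintype, Fintype.sum_bool,
    hslope, hslope]
  simp [Tangent.sign, interiorTangent]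

theorem ord_ray_eq_zero {f : Γ.Point → ℝ} {η : Γ.Tangent p} {s : ℝ} {m : ℤ}
    (hs : η.param s ∈ Set.Ioo 0 (Γ.len η.e))
    (hf : ∀ᶠ v in 𝓝 s, f (η.ray v) = f (η.ray s) + m * (v - s)) : ord f (η.ray s) = 0 := by
  have hsign : (η.sign : ℝ) * η.sign = 1 := by exact_mod_cast η.sign_mul_sign
  have hparam (u : ℝ) : η.param (η.sign * (u - η.t)) = u := by
    rw [Tangent.param, ← mul_assoc, hsign]
    ring
  have htendsto : Filter.Tendsto (fun u => η.sign * (u - η.t)) (𝓝 (η.param s)) (𝓝 s) := by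
    refine Continuous.tendsto' (by fun_prop) _ _ ?_
    rw [Tangent.param, add_sub_cancel_left, ← mul_assoc, hsign, one_mul]
  rw [η.ray_eq]
  refine ord_edgePoint_eq_zero (m := η.sign * m) hs ?_
  filter_upwards [htendsto.eventually hf] with u hu
  rw [η.ray_eq, η.ray_eq, hparam] at hu
  rw [hu, Tangent.param]
  push_cast
  linear_combination (m * s : ℝ) * hsign

theorem slope_add_const (f : Γ.Point → ℝ) (c : ℝ) (η : Γ.Tangent p) :
    slope (fun q => f q + c) η = slope f η := by
  have hiff (m : ℤ) : HasSlope (fun q => f q + c) η m ↔ HasSlope f η m :=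
    Filter.eventually_congr (.of_forall fun s => by rw [add_right_comm, add_left_inj])
  by_cases hm : ∃ m, HasSlope f η m
  · obtain ⟨m, hm⟩ := hm
    rw [hm.slope_eq, ((hiff m).2 hm).slope_eq]
  · rw [slope, slope, dif_neg hm, dif_neg (by simpa only [hiff] using hm)]

theorem ord_add_const (f : Γ.Point → ℝ) (c : ℝ) (p : Γ.Point) :
    ord (fun q => f q + c) p = ord f p := by
  simp only [ord, slope_add_const]

theorem DivAddGE.add_const {D A : Γ.Divisor} {f : Γ.Point → ℝ} (hf : DivAddGE D f A) (c : ℝ) :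
    DivAddGE D (fun q => f q + c) A := fun p => by
  rw [ord_add_const]
  exact hf p

theorem slope_sub_slope_le_ord_sub_ord [Finite E] {f h : Γ.Point → ℝ}
    (hle : ∀ θ : Γ.Tangent p, slope f θ ≤ slope h θ) (η : Γ.Tangent p) :
    slope h η - slope f η ≤ ord f p - ord h p := by
  have := Fintype.ofFinite (Γ.Tangent p)
  have hsum : ord f p - ord h p = ∑ θ : Γ.Tangent p, (slope h θ - slope f θ) := by
    rw [ord, ord, finsum_eq_sum_of_fintype, finsum_eq_sum_of_fintype, Finset.sum_sub_distrib]
    ring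
  rw [hsum]
  exact Finset.single_le_sum (f := fun θ => slope h θ - slope f θ)
    (fun θ _ => sub_nonneg.2 (hle θ)) (Finset.mem_univ η)

theorem IsPL.exists_forall_abs_le [Finite E]
    (hΓ : ∀ v : V, ∃ e : E, Γ.src e = v ∨ Γ.tgt e = v) {f : Γ.Point → ℝ} (hf : IsPL f) :
    ∃ C, ∀ p, |f p| ≤ C := by
  choose C hC using fun e => isCompact_Icc.exists_bound_of_continuousOn (hf e).1
  obtain ⟨B, hB⟩ := (Set.finite_range C).bddAbove
  refine ⟨B, fun p => ?_⟩
  obtain ⟨e, t, ht, rfl⟩ := exists_edgePoint_eq hΓ p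
  exact (hC e t ht).trans (hB ⟨e, rfl⟩)

theorem IsPL.tendsto_ray {f : Γ.Point → ℝ} (hf : IsPL f) (η : Γ.Tangent p) :
    Filter.Tendsto (fun s => f (η.ray s)) (𝓝[≥] 0) (𝓝 (f p)) := by
  have haffine : Filter.Tendsto (fun s : ℝ => f p + slope f η * s) (𝓝[≥] 0) (𝓝 (f p)) :=
    (Continuous.tendsto' (by fun_prop) _ _ (by simp)).mono_left nhdsWithin_le_nhds
  refine haffine.congr' ?_
  rw [← Set.Ioi_insert, nhdsWithin_insert, Filter.EventuallyEq, Filter.eventually_sup]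
  exact ⟨by simp, (hf.hasSlope η).mono fun s hs => hs.symm⟩

theorem IsPL.tendsto_ray_mul {f : Γ.Point → ℝ} (hf : IsPL f) (η : Γ.Tangent p) (n : ℕ) :
    Filter.Tendsto (fun t : ℝ => f (η.ray (n * t))) (𝓝[>] 0) (𝓝 (f p)) := by
  have hmul : Filter.Tendsto (fun t : ℝ => n * t) (𝓝[>] 0) (𝓝 0) :=
    (Continuous.tendsto' (by fun_prop) _ _ (mul_zero _)).mono_left nhdsWithin_le_nhds
  refine (hf.tendsto_ray η).comp (tendsto_nhdsWithin_iff.2 ⟨hmul, ?_⟩)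
  filter_upwards [self_mem_nhdsWithin] with t ht
  exact mul_nonneg n.cast_nonneg (Set.mem_Ioi.1 ht).le

section Minimizers

variable {X : Type*} {G : Finset (X → ℝ)} {a b : (X → ℝ) → ℝ} {g : X → ℝ} {x : X}

/-- The members `g` of `G` at which the minimum of the numbers `g x + a g` is attained. -/
def minimizers (G : Finset (X → ℝ)) (a : (X → ℝ) → ℝ) (x : X) : Set (X → ℝ) :=
  {g ∈ G | ∀ g' ∈ G, g x + a g ≤ g' x + a g'}

/-- The tropical linear combination of the members of `G` with coefficients `a`. -/
noncomputable def tropicalComb (G : Finset (X → ℝ)) (hG : G.Nonempty) (a : (X → ℝ) → ℝ)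
    (x : X) : ℝ :=
  G.inf' hG fun g => g x + a g

theorem mem_of_mem_minimizers (hg : g ∈ minimizers G a x) : g ∈ G := hg.1

theorem minimizers_nonempty (hG : G.Nonempty) (a : (X → ℝ) → ℝ) (x : X) :
    (minimizers G a x).Nonempty :=
  G.exists_min_image (fun g => g x + a g) hG

theorem add_eq_add_of_mem_minimizers {g' : X → ℝ} (hg : g ∈ minimizers G a x)
    (hg' : g' ∈ minimizers G a x) : g x + a g = g' x + a g' :=
  le_antisymm (hg.2 g' hg'.1) (hg'.2 g hg.1)

theorem tropicalComb_le (hG : G.Nonempty) (hg : g ∈ G) : tropicalComb G hG a x ≤ g x + a g :=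
  Finset.inf'_le _ hg

theorem tropicalComb_eq_of_mem_minimizers (hG : G.Nonempty) (hg : g ∈ minimizers G a x) :
    tropicalComb G hG a x = g x + a g :=
  le_antisymm (tropicalComb_le hG hg.1) (Finset.le_inf' hG _ hg.2)

theorem tropicalComb_add_const (hG : G.Nonempty) (c : ℝ) :
    (tropicalComb G hG fun g => a g + c) = fun x => tropicalComb G hG a x + c := by
  ext x
  obtain ⟨g, hg⟩ := minimizers_nonempty hG a x
  have hg' : g ∈ minimizers G (fun g => a g + c) x :=
    ⟨hg.1, fun g' hg' => by linarith [hg.2 g' hg']⟩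
  rw [tropicalComb_eq_of_mem_minimizers hG hg, tropicalComb_eq_of_mem_minimizers hG hg', add_assoc]

theorem eventually_minimizers_subset {ι : Type*} {l : Filter ι} {α : ι → (X → ℝ) → ℝ} {y : ι → X}
    (h : ∀ g ∈ G, Filter.Tendsto (fun i => g (y i) + α i g) l (𝓝 (g x + b g))) :
    ∀ᶠ i in l, minimizers G (α i) (y i) ⊆ minimizers G b x := by
  have hmem : ∀ g ∈ G, ∀ᶠ i in l, g ∈ minimizers G (α i) (y i) → g ∈ minimizers G b x := by
    intro g hg
    by_cases hgx : g ∈ minimizers G b x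
    · exact .of_forall fun _ _ => hgx
    · obtain ⟨g', hg', hlt⟩ : ∃ g' ∈ G, g' x + b g' < g x + b g := by
        by_contra! hle
        exact hgx ⟨hg, hle⟩
      filter_upwards [(h g' hg').eventually_lt (h g hg) hlt] with i hi hmin
      exact absurd (hmin.2 g' hg') hi.not_ge
  filter_upwards [(Filter.eventually_all_finset G).2 hmem] with i hi g hg
  exact hi g hg.1 hg

end Minimizers

section TropicalSpan

variable {G T : Finset (Γ.Point → ℝ)} {S : Set (Γ.Point → ℝ)} {a : (Γ.Point → ℝ) → ℝ}

theorem tropicalComb_mem_tropicalSpan (hG : G.Nonempty) (a : (Γ.Point → ℝ) → ℝ)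
    (hGS : (G : Set (Γ.Point → ℝ)) ⊆ S) : tropicalComb G hG a ∈ tropicalSpan S :=
  ⟨G, hG, a, hGS, fun _ => rfl⟩

theorem exists_eq_tropicalComb {f : Γ.Point → ℝ} (hf : f ∈ tropicalSpan S) :
    ∃ (T : Finset (Γ.Point → ℝ)) (hT : T.Nonempty) (a : (Γ.Point → ℝ) → ℝ),
      (T : Set (Γ.Point → ℝ)) ⊆ S ∧ f = tropicalComb T hT a := by
  obtain ⟨T, hT, a, hTS, hf⟩ := hf
  exact ⟨T, hT, a, hTS, funext hf⟩

theorem subset_tropicalSpan (S : Set (Γ.Point → ℝ)) : S ⊆ tropicalSpan S := fun g hg =>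
  ⟨{g}, Finset.singleton_nonempty g, 0, by simpa using hg, by simp⟩

theorem add_const_mem_tropicalSpan {f : Γ.Point → ℝ} (hf : f ∈ tropicalSpan S) (c : ℝ) :
    (fun p => f p + c) ∈ tropicalSpan S := by
  obtain ⟨T, hT, a, hTS, rfl⟩ := exists_eq_tropicalComb hf
  rw [← tropicalComb_add_const hT c]
  exact tropicalComb_mem_tropicalSpan hT _ hTS

theorem TropicallyDependent.exists_nontrivial_minimizers (hT : TropicallyDependent T) :
    ∃ a, ∀ p, (minimizers T a p).Nontrivial := by
  obtain ⟨a, ha⟩ := hT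
  refine ⟨a, fun p => ?_⟩
  obtain ⟨f, hf, g, hg, hne, heq, hmin⟩ := ha p
  exact ⟨f, ⟨hf, hmin⟩, g, ⟨hg, heq ▸ hmin⟩, hne⟩

theorem eventually_minimizers_ray_subset (hG : ∀ g ∈ G, IsPL g) (a : (Γ.Point → ℝ) → ℝ)
    (η : Γ.Tangent p) : ∀ᶠ s in 𝓝[>] (0 : ℝ), ∀ g ∈ minimizers G a (η.ray s),
      g ∈ minimizers G a p ∧ ∀ g' ∈ minimizers G a p, slope g η ≤ slope g' η := by
  have hsub : ∀ᶠ s in 𝓝[>] (0 : ℝ), minimizers G a (η.ray s) ⊆ minimizers G a p :=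
    eventually_minimizers_subset fun g hg =>
      (((hG g hg).tendsto_ray η).mono_left (nhdsWithin_mono _ Set.Ioi_subset_Ici_self)).add_const _
  filter_upwards [hsub, (Filter.eventually_all_finset G).2 fun g hg => (hG g hg).hasSlope η,
    self_mem_nhdsWithin] with s hsub haffine hs g hg
  refine ⟨hsub hg, fun g' hg' => ?_⟩
  have hp := add_eq_add_of_mem_minimizers (hsub hg) hg'
  have hray := hg.2 g' hg'.1
  rw [haffine g hg.1, haffine g' hg'.1] at hray
  have hmul : (slope g η : ℝ) * s ≤ slope g' η * s := by linarith
  exact_mod_cast le_of_mul_le_mul_right hmul hs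

theorem hasSlope_tropicalComb (hG : ∀ g ∈ G, IsPL g) (hne : G.Nonempty) {η : Γ.Tangent p}
    {g : Γ.Point → ℝ} (hg : g ∈ minimizers G a p)
    (hmin : ∀ g' ∈ minimizers G a p, slope g η ≤ slope g' η) :
    HasSlope (tropicalComb G hne a) η (slope g η) := by
  filter_upwards [eventually_minimizers_ray_subset hG a η,
    (Filter.eventually_all_finset G).2 fun g hg => (hG g hg).hasSlope η] with s hs haffine
  obtain ⟨g', hg'⟩ := minimizers_nonempty hne a (η.ray s)
  obtain ⟨hg'p, hg'min⟩ := hs g' hg'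
  rw [tropicalComb_eq_of_mem_minimizers hne hg', tropicalComb_eq_of_mem_minimizers hne hg'p,
    haffine g' hg'.1, (hmin g' hg'p).antisymm (hg'min g hg), add_right_comm]

theorem exists_slope_tropicalComb_eq (hG : ∀ g ∈ G, IsPL g) (hne : G.Nonempty)
    (a : (Γ.Point → ℝ) → ℝ) (η : Γ.Tangent p) :
    ∃ g ∈ minimizers G a p, slope (tropicalComb G hne a) η = slope g η ∧
      ∀ g' ∈ minimizers G a p, slope g η ≤ slope g' η := by
  obtain ⟨g, hg, hmin⟩ := Set.exists_min_image (minimizers G a p) (fun g => slope g η)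
    (G.finite_toSet.subset fun _ => mem_of_mem_minimizers) (minimizers_nonempty hne a p)
  exact ⟨g, hg, (hasSlope_tropicalComb hG hne hg hmin).slope_eq, hmin⟩

theorem slope_tropicalComb_le (hG : ∀ g ∈ G, IsPL g) (hne : G.Nonempty) {η : Γ.Tangent p}
    {g : Γ.Point → ℝ} (hg : g ∈ minimizers G a p) :
    slope (tropicalComb G hne a) η ≤ slope g η := by
  obtain ⟨g₀, -, hslope, hmin⟩ := exists_slope_tropicalComb_eq hG hne a η
  exact hslope ▸ hmin g hg

theorem exists_ne_mem_minimizers_slope_eq (hT : ∀ f ∈ T, IsPL f)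
    (ha : ∀ q, (minimizers T a q).Nontrivial) (η : Γ.Tangent p) :
    ∃ f ∈ minimizers T a p, ∃ g ∈ minimizers T a p, f ≠ g ∧ slope f η = slope g η ∧
      ∀ h ∈ minimizers T a p, slope f η ≤ slope h η := by
  obtain ⟨s, hs⟩ := (eventually_minimizers_ray_subset hT a η).exists
  obtain ⟨f, hf, g, hg, hne⟩ := ha (η.ray s)
  obtain ⟨⟨hfp, hfmin⟩, hgp, hgmin⟩ := hs f hf, hs g hg
  exact ⟨f, hfp, g, hgp, hne, (hfmin g hgp).antisymm (hgmin f hfp), hfmin⟩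

theorem not_tropicallyDependent_of_injOn_slope (hT : ∀ f ∈ T, IsPL f) {η : Γ.Tangent p}
    (hinj : Set.InjOn (fun f => slope f η) T) : ¬ TropicallyDependent T := by
  intro hdep
  obtain ⟨a, ha⟩ := hdep.exists_nontrivial_minimizers
  obtain ⟨f, hf, g, hg, hne, heq, -⟩ := exists_ne_mem_minimizers_slope_eq hT ha η
  exact hne (hinj hf.1 hg.1 heq)

theorem exists_slope_le_of_tropicallyDependent_insert [DecidableEq (Γ.Point → ℝ)]
    {h : Γ.Point → ℝ} (hT : ∀ f ∈ insert h T, IsPL f) {η : Γ.Tangent p}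
    (hinj : Set.InjOn (fun f => slope f η) T) (hdep : TropicallyDependent (insert h T))
    (θ : Γ.Tangent p) : ∃ f ∈ T, slope f θ ≤ slope h θ := by
  obtain ⟨a, ha⟩ := hdep.exists_nontrivial_minimizers
  have hmem {f : Γ.Point → ℝ} (hf : f ∈ minimizers (insert h T) a p) (hne : f ≠ h) : f ∈ T :=
    (Finset.mem_insert.1 hf.1).resolve_left hne
  have hmin : h ∈ minimizers (insert h T) a p := by
    obtain ⟨f, hf, g, hg, hne, heq, -⟩ := exists_ne_mem_minimizers_slope_eq hT ha η
    by_contra hh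
    exact hne (hinj (hmem hf (ne_of_mem_of_not_mem hf hh)) (hmem hg (ne_of_mem_of_not_mem hg hh))
      heq)
  obtain ⟨f, hf, g, hg, hne, heq, hle⟩ := exists_ne_mem_minimizers_slope_eq hT ha θ
  by_cases hfh : f = h
  · exact ⟨g, hmem hg (hfh ▸ hne.symm), heq ▸ hle h hmin⟩
  · exact ⟨f, hmem hf hfh, hle h hmin⟩

end TropicalSpan

/-- `[0, ε)` is an initial segment of the ray along `η` on which the members of `G` are affine and
which, away from its origin, runs in the interior of an edge and avoids the support of `D`. -/
structure IsSegment (η : Γ.Tangent p) (D : Γ.Divisor) (G : Finset (Γ.Point → ℝ)) (ε : ℝ) :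
    Prop where
  pos : 0 < ε
  affine : ∀ g ∈ G, ∀ s ∈ Set.Ico 0 ε, g (η.ray s) = g p + slope g η * s
  param_mem : ∀ s ∈ Set.Ioo 0 ε, η.param s ∈ Set.Ioo 0 (Γ.len η.e)
  divisor_eq_zero : ∀ s ∈ Set.Ioo 0 ε, D (η.ray s) = 0

/-- The sum of the points at distances `t, 2t, …, nt` along `η`. -/
noncomputable def raySum (η : Γ.Tangent p) (n : ℕ) (t : ℝ) : Γ.Divisor :=
  ∑ i ∈ Finset.Icc 1 n, Finsupp.single (η.ray (i * t)) 1

theorem deg_sum {ι : Type*} (s : Finset ι) (A : ι → Γ.Divisor) :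
    deg (∑ i ∈ s, A i) = ∑ i ∈ s, deg (A i) :=
  (Finsupp.sum_finsetSum_index (fun _ => rfl) (fun _ _ _ => rfl)).symm

theorem deg_raySum (η : Γ.Tangent p) (n : ℕ) (t : ℝ) : deg (raySum η n t) = n := by
  have hsingle (q : Γ.Point) : deg (Finsupp.single q 1) = 1 := Finsupp.sum_single_index rfl
  simp [raySum, deg_sum, hsingle]

theorem raySum_nonneg (η : Γ.Tangent p) (n : ℕ) (t : ℝ) : 0 ≤ raySum η n t :=
  Finset.sum_nonneg fun _ _ => Finsupp.single_nonneg.2 zero_le_one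

theorem one_le_raySum {n i : ℕ} (hi : i ∈ Finset.Icc 1 n) (η : Γ.Tangent p) (t : ℝ) :
    1 ≤ raySum η n t (η.ray (i * t)) := by
  have hle := Finset.single_le_sum
    (f := fun i : ℕ => Finsupp.single (M := ℤ) (η.ray (i * t)) 1)
    (fun _ _ => Finsupp.single_nonneg.2 zero_le_one) hi
  simpa [raySum] using hle (η.ray (i * t))

theorem exists_isSegment {G : Finset (Γ.Point → ℝ)} (hG : ∀ g ∈ G, IsPL g) (η : Γ.Tangent p)
    (D : Γ.Divisor) : ∃ ε, IsSegment η D G ε := by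
  have haffine := (Filter.eventually_all_finset G).2 fun g hg => (hG g hg).hasSlope η
  have havoid := (Filter.eventually_all_finset D.support).2 fun q _ => η.eventually_ray_ne q
  obtain ⟨ε, hε, hsub⟩ :=
    mem_nhdsGT_iff_exists_Ioo_subset.1 ((haffine.and havoid).and η.eventually_param_mem)
  refine ⟨ε, hε, fun g hg s hs => ?_, fun s hs => (hsub hs).2, fun s hs => ?_⟩
  · rcases hs.1.eq_or_lt with rfl | hpos
    · simp
    · exact (hsub ⟨hpos, hs.2⟩).1.1 g hg
  · by_contra hne
    exact (hsub hs).1.2 _ (Finsupp.mem_support_iff.2 hne) rfl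

namespace IsSegment

variable {η : Γ.Tangent p} {D : Γ.Divisor} {G G' : Finset (Γ.Point → ℝ)} {ε s : ℝ}
  {a : (Γ.Point → ℝ) → ℝ} {g : Γ.Point → ℝ}

theorem mono (hseg : IsSegment η D G ε) (hsub : G' ⊆ G) : IsSegment η D G' ε where
  pos := hseg.pos
  affine g hg := hseg.affine g (hsub hg)
  param_mem := hseg.param_mem
  divisor_eq_zero := hseg.divisor_eq_zero

theorem eventually_eq_affine (hseg : IsSegment η D G ε) (hs : s ∈ Set.Ioo 0 ε) :
    ∀ᶠ v in 𝓝 s, ∀ g ∈ G, g (η.ray v) = g (η.ray s) + slope g η * (v - s) := by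
  filter_upwards [Ioo_mem_nhds hs.1 hs.2] with v hv g hg
  rw [hseg.affine g hg v ⟨hv.1.le, hv.2⟩, hseg.affine g hg s ⟨hs.1.le, hs.2⟩]
  ring

theorem tendsto_ray (hseg : IsSegment η D G ε) (hs : s ∈ Set.Ioo 0 ε) (hg : g ∈ G) :
    Filter.Tendsto (fun v => g (η.ray v)) (𝓝 s) (𝓝 (g (η.ray s))) := by
  have haffine : Filter.Tendsto (fun v => g (η.ray s) + slope g η * (v - s)) (𝓝 s)
      (𝓝 (g (η.ray s))) := Continuous.tendsto' (by fun_prop) _ _ (by simp)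
  exact haffine.congr' ((hseg.eventually_eq_affine hs).mono fun v hv => (hv g hg).symm)

theorem slope_le_slope_of_lt (hseg : IsSegment η D G ε) {s' : ℝ} (hs : 0 ≤ s) (hlt : s < s')
    (hs' : s' < ε) {g' : Γ.Point → ℝ} (hg : g ∈ minimizers G a (η.ray s))
    (hg' : g' ∈ minimizers G a (η.ray s')) : slope g' η ≤ slope g η := by
  have hmin := hg.2 g' hg'.1
  have hmin' := hg'.2 g hg.1
  have hsε : s ∈ Set.Ico 0 ε := ⟨hs, hlt.trans hs'⟩
  have hsε' : s' ∈ Set.Ico 0 ε := ⟨hs.trans hlt.le, hs'⟩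
  rw [hseg.affine g hg.1 s hsε, hseg.affine g' hg'.1 s hsε] at hmin
  rw [hseg.affine g hg.1 s' hsε', hseg.affine g' hg'.1 s' hsε'] at hmin'
  have hmul : (slope g' η : ℝ) * (s' - s) ≤ slope g η * (s' - s) := by linarith
  exact_mod_cast le_of_mul_le_mul_right hmul (sub_pos.2 hlt)

theorem exists_slope_lt_of_ord_ne_zero (hseg : IsSegment η D G ε) (hs : s ∈ Set.Ioo 0 ε)
    (hne : G.Nonempty) (hord : ord (tropicalComb G hne a) (η.ray s) ≠ 0) :
    ∃ g ∈ minimizers G a (η.ray s), ∃ g' ∈ minimizers G a (η.ray s),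
      slope g η < slope g' η := by
  by_contra! hle
  obtain ⟨g₀, hg₀⟩ := minimizers_nonempty hne a (η.ray s)
  have hsub : ∀ᶠ v in 𝓝 s, minimizers G a (η.ray v) ⊆ minimizers G a (η.ray s) :=
    eventually_minimizers_subset fun g hg => (hseg.tendsto_ray hs hg).add_const _
  refine hord (ord_ray_eq_zero (m := slope g₀ η) (hseg.param_mem s hs) ?_)
  filter_upwards [hsub, hseg.eventually_eq_affine hs] with v hsub haffine
  obtain ⟨g, hg⟩ := minimizers_nonempty hne a (η.ray v)
  have hslope : slope g η = slope g₀ η :=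
    (hle g₀ hg₀ g (hsub hg)).antisymm (hle g (hsub hg) g₀ hg₀)
  rw [tropicalComb_eq_of_mem_minimizers hne hg, tropicalComb_eq_of_mem_minimizers hne (hsub hg),
    haffine g hg.1, hslope, add_right_comm]

theorem exists_slope_lt_of_raySum_le (hseg : IsSegment η D G ε) {n i : ℕ} {t : ℝ} (ht : 0 < t)
    (hnt : n * t < ε) (hne : G.Nonempty) {A : Γ.Divisor} (hA : raySum η n t ≤ A)
    (hcomb : DivAddGE D (tropicalComb G hne a) A) (hi : i ∈ Finset.Icc 1 n) :
    ∃ g ∈ minimizers G a (η.ray (i * t)), ∃ g' ∈ minimizers G a (η.ray (i * t)),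
      slope g η < slope g' η := by
  obtain ⟨hi1, hin⟩ := Finset.mem_Icc.1 hi
  have hit : (i : ℝ) * t ∈ Set.Ioo 0 ε := by
    refine ⟨by positivity, lt_of_le_of_lt ?_ hnt⟩
    gcongr
  refine hseg.exists_slope_lt_of_ord_ne_zero hit hne fun hord => ?_
  have hone := (one_le_raySum hi η t).trans (hA _)
  have hle := hcomb (η.ray (i * t))
  rw [hord, hseg.divisor_eq_zero _ hit] at hle
  omega

/-- At each of the `n` points a minimizer is chosen whose slope is less than that of another
minimizer there, hence less than that of every minimizer at an earlier point. -/
theorem exists_strictAntiOn_slope (hseg : IsSegment η D G ε) (hG : ∀ g ∈ G, IsPL g) {n : ℕ}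
    {t : ℝ} (ht : 0 < t) (hnt : n * t < ε) (hne : G.Nonempty) {A : Γ.Divisor}
    (hA : raySum η n t ≤ A) (hcomb : DivAddGE D (tropicalComb G hne a) A) :
    ∃ ψ : ℕ → Γ.Point → ℝ, (∀ i ≤ n, ψ i ∈ minimizers G a (η.ray (i * t))) ∧
      StrictAntiOn (fun i => slope (ψ i) η) (Set.Iic n) ∧
      slope (ψ 0) η = slope (tropicalComb G hne a) η := by
  obtain ⟨g₀, hg₀, hslope, -⟩ := exists_slope_tropicalComb_eq hG hne a η
  choose! φ hφ χ hχ hlt using fun i (hi : i ∈ Finset.Icc 1 n) =>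
    hseg.exists_slope_lt_of_raySum_le ht hnt hne hA hcomb hi
  let ψ : ℕ → Γ.Point → ℝ := fun i => if i = 0 then g₀ else φ i
  have hψ : ∀ i ≤ n, ψ i ∈ minimizers G a (η.ray (i * t)) := by
    rintro (_ | i) hi
    · simpa [ψ] using hg₀
    · exact hφ (i + 1) (Finset.mem_Icc.2 ⟨by omega, hi⟩)
  refine ⟨ψ, hψ, strictAntiOn_Iic_of_succ_lt fun i hi => ?_, hslope.symm⟩
  have hi' : i + 1 ∈ Finset.Icc 1 n := Finset.mem_Icc.2 ⟨by omega, hi⟩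
  refine (hlt (i + 1) hi').trans_le (hseg.slope_le_slope_of_lt (by positivity) ?_ ?_
    (hψ i hi.le) (hχ (i + 1) hi'))
  · gcongr
    omega
  · refine lt_of_le_of_lt ?_ hnt
    gcongr
    exact_mod_cast hi

end IsSegment

namespace IsFGTropical

variable {M : Set (Γ.Point → ℝ)}

theorem exists_generators (hM : IsFGTropical M) :
    ∃ G : Finset (Γ.Point → ℝ), M = tropicalSpan (G : Set (Γ.Point → ℝ)) ∧ ∀ g ∈ G, g ∈ M := by
  obtain ⟨G, hG, rfl⟩ := hM
  exact ⟨hG.toFinset, by simp, fun g hg => subset_tropicalSpan G (by simpa using hg)⟩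

theorem add_const_mem (hM : IsFGTropical M) {f : Γ.Point → ℝ} (hf : f ∈ M) (c : ℝ) :
    (fun q => f q + c) ∈ M := by
  obtain ⟨G, -, rfl⟩ := hM
  exact add_const_mem_tropicalSpan hf c

theorem infinite [Nonempty Γ.Point] (hM : IsFGTropical M) (hne : M.Nonempty) : M.Infinite := by
  obtain ⟨f, hf⟩ := hne
  refine Set.infinite_of_injective_forall_mem (f := fun c : ℝ => fun q => f q + c) ?_
    fun c => hM.add_const_mem hf c
  exact fun c c' h => add_left_cancel (congrFun h (Classical.arbitrary Γ.Point))

end IsFGTropical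

namespace IsTLS

variable {D : Γ.Divisor} {r : ℕ} {M : Set (Γ.Point → ℝ)} {f g : Γ.Point → ℝ}
  {T : Finset (Γ.Point → ℝ)} {η : Γ.Tangent p}

theorem isPL (hM : IsTLS D r M) (hf : f ∈ M) : IsPL f :=
  (hM.subset hf).1

theorem of_isEmpty [IsEmpty Γ.Point] (hM : IsTLS D r M) (hne : M.Nonempty) (k : ℕ) :
    IsTLS D k M where
  subset := hM.subset
  fg := hM.fg
  rank _ _ _ := hne.imp fun _ hf => ⟨hf, isEmptyElim⟩
  dependent T _ hcard := by
    have := Finset.card_le_one_of_subsingleton T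
    omega

theorem card_le_of_injOn_slope (hM : IsTLS D r M) (hT : (T : Set (Γ.Point → ℝ)) ⊆ M)
    (hinj : Set.InjOn (fun f => slope f η) T) : T.card ≤ r + 1 := by
  by_contra! hlt
  obtain ⟨T', hT', hcard⟩ := Finset.exists_subset_card_eq (Nat.succ_le_of_lt hlt)
  have hsub : (T' : Set (Γ.Point → ℝ)) ⊆ T := Finset.coe_subset.2 hT'
  exact not_tropicallyDependent_of_injOn_slope (fun f hf => hM.isPL (hT (hsub hf)))
    (hinj.mono hsub) (hM.dependent T' (hsub.trans hT) hcard)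

theorem card_le_of_subset_slopeSet (hM : IsTLS D r M) {W : Finset ℤ}
    (hW : (W : Set ℤ) ⊆ slopeSet M η) : W.card ≤ r + 1 := by
  obtain ⟨T, hT, hinj, rfl⟩ := Finset.exists_subset_injOn_image_eq_of_surjOn M W hW
  exact Finset.card_image_le.trans (hM.card_le_of_injOn_slope hT hinj)

theorem finite_slopeSet (hM : IsTLS D r M) (η : Γ.Tangent p) : (slopeSet M η).Finite := by
  by_contra hinf
  obtain ⟨W, hW, hcard⟩ := Set.Infinite.exists_subset_card_eq hinf (r + 2)
  have := hM.card_le_of_subset_slopeSet hW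
  omega

theorem ncard_slopeSet_le (hM : IsTLS D r M) (η : Γ.Tangent p) :
    (slopeSet M η).ncard ≤ r + 1 := by
  rw [Set.ncard_eq_toFinset_card _ (hM.finite_slopeSet η)]
  exact hM.card_le_of_subset_slopeSet (η := η) (by simp)

theorem le_ncard_slopeSet (hM : IsTLS D r M) (η : Γ.Tangent p) :
    r + 1 ≤ (slopeSet M η).ncard := by
  obtain ⟨G, hMG, hG⟩ := hM.fg.exists_generators
  obtain ⟨ε, hseg⟩ := exists_isSegment (fun g hg => hM.isPL (hG g hg)) η D
  have ht : 0 < ε / (r + 1) := div_pos hseg.pos (by positivity)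
  have hrt : r * (ε / (r + 1)) < ε := by
    rw [mul_div_assoc', div_lt_iff₀ (by positivity)]
    linarith [hseg.pos]
  obtain ⟨f, hf, hdiv⟩ := hM.rank _ (raySum_nonneg η r (ε / (r + 1))) (deg_raySum η r _)
  obtain ⟨T, hT, a, hTG, rfl⟩ := exists_eq_tropicalComb (hMG ▸ hf)
  obtain ⟨ψ, hψ, hanti, -⟩ := (hseg.mono (Finset.coe_subset.1 hTG)).exists_strictAntiOn_slope
    (fun g hg => hM.isPL (hG g (hTG hg))) ht hrt hT le_rfl hdiv
  rw [← Set.ncard_Iic_nat r, ← hanti.injOn.ncard_image]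
  refine Set.ncard_le_ncard ?_ (hM.finite_slopeSet η)
  rintro _ ⟨i, hi, rfl⟩
  exact ⟨ψ i, hG _ (hTG (hψ i hi).1), rfl⟩

theorem ncard_slopeSet (hM : IsTLS D r M) (η : Γ.Tangent p) : (slopeSet M η).ncard = r + 1 :=
  (hM.ncard_slopeSet_le η).antisymm (hM.le_ncard_slopeSet η)

theorem exists_slope_le (hM : IsTLS D r M) (hT : (T : Set (Γ.Point → ℝ)) ⊆ M)
    (hcard : T.card = r + 1) (hinj : Set.InjOn (fun f => slope f η) T) (hf : f ∈ M)
    (θ : Γ.Tangent p) : ∃ g ∈ T, slope g θ ≤ slope f θ := by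
  classical
  by_cases hfT : f ∈ T
  · exact ⟨f, hfT, le_rfl⟩
  have hsub : ((insert f T : Finset (Γ.Point → ℝ)) : Set (Γ.Point → ℝ)) ⊆ M := by
    rw [Finset.coe_insert]
    exact Set.insert_subset hf hT
  exact exists_slope_le_of_tropicallyDependent_insert (fun g hg => hM.isPL (hsub hg)) hinj
    (hM.dependent _ hsub (by rw [Finset.card_insert_of_notMem hfT, hcard])) θ

end IsTLS

theorem strictMonoOn_ncard_lt {α : Type*} [Preorder α] {S : Set α} (hS : S.Finite) :
    StrictMonoOn (fun s => {t ∈ S | t < s}.ncard) S := by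
  intro s hs t _ hst
  refine Set.ncard_lt_ncard ⟨fun u hu => ⟨hu.1, hu.2.trans hst⟩, fun hsub => ?_⟩
    (hS.subset (Set.sep_subset _ _))
  exact lt_irrefl s (hsub ⟨hs, hst⟩).2

/-- The functions in `M` whose position in the local array of `M` at `p` lies in the principal
subarray of `x`. -/
def principalSeries (M : Set (Γ.Point → ℝ)) (p : Γ.Point) (x : Γ.Tangent p → ℕ) :
    Set (Γ.Point → ℝ) :=
  {f ∈ M | x ≤ position M p f}

theorem principalSeries_subset (M : Set (Γ.Point → ℝ)) (x : Γ.Tangent p → ℕ) :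
    principalSeries M p x ⊆ M :=
  Set.sep_subset _ _

namespace IsTLS

variable {D : Γ.Divisor} {r : ℕ} {M : Set (Γ.Point → ℝ)} {f g : Γ.Point → ℝ}

theorem position_le_position_iff (hM : IsTLS D r M) (hf : f ∈ M) (hg : g ∈ M) :
    position M p f ≤ position M p g ↔ ∀ η : Γ.Tangent p, slope f η ≤ slope g η :=
  forall_congr' fun η =>
    (strictMonoOn_ncard_lt (hM.finite_slopeSet η)).le_iff_le ⟨f, hf, rfl⟩ ⟨g, hg, rfl⟩

theorem finite_slopeSet_principalSeries (hM : IsTLS D r M) (x : Γ.Tangent p → ℕ)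
    (η : Γ.Tangent p) : (slopeSet (principalSeries M p x) η).Finite :=
  (hM.finite_slopeSet η).subset (Set.image_mono (principalSeries_subset M x))

theorem axisRank_principal (hM : IsTLS D r M) (x : Γ.Tangent p → ℕ) (η : Γ.Tangent p) :
    axisRank (principal (localArray M p) x) η =
      (slopeSet (principalSeries M p x) η).ncard - 1 := by
  have himage : (fun y => y η) '' principal (localArray M p) x =
      (fun s => {t ∈ slopeSet M η | t < s}.ncard) '' slopeSet (principalSeries M p x) η := by
    ext n
    constructor
    · rintro ⟨_, ⟨⟨f, hf, rfl⟩, hx⟩, rfl⟩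
      exact ⟨_, ⟨f, ⟨hf, hx⟩, rfl⟩, rfl⟩
    · rintro ⟨_, ⟨f, ⟨hf, hx⟩, rfl⟩, rfl⟩
      exact ⟨_, ⟨⟨f, hf, rfl⟩, hx⟩, rfl⟩
  have hinj : Set.InjOn (fun s => {t ∈ slopeSet M η | t < s}.ncard)
      (slopeSet (principalSeries M p x) η) :=
    (strictMonoOn_ncard_lt (hM.finite_slopeSet η)).injOn.mono
      (Set.image_mono (principalSeries_subset M x))
  rw [axisRank, himage, hinj.ncard_image]

end IsTLS

/-- `(D, M)` is a tropical linear series of rank `r` such that any `k + 1 ≤ r + 1` functions in `M`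
lie in a tropical linear subseries of rank `k`. This is the part of strong recursivity
from which the local rank property is derived. -/
structure IsTLSWithSubseries (D : Γ.Divisor) (r : ℕ) (M : Set (Γ.Point → ℝ)) : Prop
    extends IsTLS D r M where
  exists_subseries : ∀ k ≤ r, ∀ T : Finset (Γ.Point → ℝ), (T : Set (Γ.Point → ℝ)) ⊆ M →
    T.card = k + 1 → ∃ M' ⊆ M, (T : Set (Γ.Point → ℝ)) ⊆ M' ∧ IsTLS D k M'

namespace IsStronglyRecursive

variable {D : Γ.Divisor} {r k : ℕ} {M : Set (Γ.Point → ℝ)}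

theorem isTLS (hM : IsStronglyRecursive D r M) : IsTLS D r M := by
  rw [IsStronglyRecursive] at hM
  exact hM.1

theorem exists_subseries_pred (hM : IsStronglyRecursive D r M) (hr : 1 ≤ r)
    {S : Set (Γ.Point → ℝ)} (hS : S ⊆ M) (hcard : S.ncard = r) :
    ∃ M' ⊆ M, S ⊆ M' ∧ IsStronglyRecursive D (r - 1) M' := by
  have hfin : S.Finite := Set.finite_of_ncard_pos (by omega)
  rw [IsStronglyRecursive] at hM
  simpa using hM.2.1 hr hfin.toFinset (by simpa using hS)
    (by rw [← Set.ncard_eq_toFinset_card _ hfin, hcard])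

theorem exists_subseries [Nonempty Γ.Point] (hM : IsStronglyRecursive D r M) (hk : k ≤ r)
    {S : Set (Γ.Point → ℝ)} (hS : S ⊆ M) (hcard : S.ncard = k + 1) :
    ∃ M' ⊆ M, S ⊆ M' ∧ IsStronglyRecursive D k M' := by
  induction r generalizing M with
  | zero =>
    obtain rfl : k = 0 := by omega
    exact ⟨M, subset_rfl, hS, hM⟩
  | succ r ih =>
    rcases hk.eq_or_lt with rfl | hlt
    · exact ⟨M, subset_rfl, hS, hM⟩
    have hne : S.Nonempty := Set.nonempty_of_ncard_ne_zero (by omega)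
    obtain ⟨S', hSS', hS', hcard'⟩ :=
      (hM.isTLS.fg.infinite (hne.mono hS)).exists_superset_ncard_eq hS
        (Set.finite_of_ncard_pos (by omega)) (k := r + 1) (by omega)
    obtain ⟨M₁, hM₁M, hS'M₁, hM₁⟩ := hM.exists_subseries_pred (by omega) hS' hcard'
    obtain ⟨M', hM'M₁, hSM', hM'⟩ := ih hM₁ (by omega) (hSS'.trans hS'M₁)
    exact ⟨M', hM'M₁.trans hM₁M, hSM', hM'⟩

theorem isTLSWithSubseries (hM : IsStronglyRecursive D r M) : IsTLSWithSubseries D r M where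
  toIsTLS := hM.isTLS
  exists_subseries k hk T hT hcard := by
    rcases isEmpty_or_nonempty Γ.Point
    · have hne : (T : Set (Γ.Point → ℝ)).Nonempty := Finset.card_pos.1 (by omega)
      exact ⟨M, subset_rfl, hT, hM.isTLS.of_isEmpty (hne.mono hT) k⟩
    · obtain ⟨M', hM'M, hTM', hM'⟩ := hM.exists_subseries hk hT (by simpa using hcard)
      exact ⟨M', hM'M, hTM', hM'.isTLS⟩

end IsStronglyRecursive

namespace IsTLSWithSubseries

variable {D : Γ.Divisor} {r : ℕ} {M : Set (Γ.Point → ℝ)}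

/-- The functions `T` in the principal series with different slopes along `η` lie in a subseries of
rank `T.card - 1`. By dependence that subseries stays in the principal series, and it has `T.card`
slopes along `θ`. -/
theorem ncard_slopeSet_principalSeries_le (hM : IsTLSWithSubseries D r M) (x : Γ.Tangent p → ℕ)
    (η θ : Γ.Tangent p) :
    (slopeSet (principalSeries M p x) η).ncard ≤ (slopeSet (principalSeries M p x) θ).ncard := by
  have hPM := principalSeries_subset M x
  have hfin := hM.finite_slopeSet_principalSeries x
  obtain ⟨T, hTP, hinj, himage⟩ := Finset.exists_subset_injOn_image_eq_of_surjOn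
    (f := fun f => slope f η) (principalSeries M p x) (hfin η).toFinset
    (by simp [slopeSet, Set.SurjOn])
  rw [Set.ncard_eq_toFinset_card _ (hfin η), ← himage, Finset.card_image_of_injOn hinj]
  rcases T.card.eq_zero_or_eq_succ_pred with hzero | hcard
  · simp [hzero]
  have hTr := hM.card_le_of_injOn_slope (hTP.trans hPM) hinj
  obtain ⟨M', hM'M, hTM', hM'⟩ := hM.exists_subseries _ (by omega) T (hTP.trans hPM) hcard
  have hM'P : M' ⊆ principalSeries M p x := by
    refine fun f hf => ⟨hM'M hf, fun ζ => ?_⟩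
    obtain ⟨g, hg, hle⟩ := hM'.exists_slope_le hTM' hcard hinj hf ζ
    exact ((hTP hg).2 ζ).trans
      ((strictMonoOn_ncard_lt (hM.finite_slopeSet ζ)).monotoneOn ⟨g, hPM (hTP hg), rfl⟩
        ⟨f, hM'M hf, rfl⟩ hle)
  rw [hcard]
  exact (hM'.ncard_slopeSet θ).ge.trans (Set.ncard_le_ncard (Set.image_mono hM'P) (hfin θ))

theorem hasRank_principal (hM : IsTLSWithSubseries D r M) (x : Γ.Tangent p → ℕ)
    (η : Γ.Tangent p) : HasRank (principal (localArray M p) x)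
      ((slopeSet (principalSeries M p x) η).ncard - 1) := fun θ => by
  rw [hM.axisRank_principal, (hM.ncard_slopeSet_principalSeries_le x η θ).antisymm
    (hM.ncard_slopeSet_principalSeries_le x θ η)]

theorem localRank_eq (hM : IsTLSWithSubseries D r M) (f : Γ.Point → ℝ) (η : Γ.Tangent p) :
    localRank M p f =
      (slopeSet (principalSeries M p (position M p f)) η).ncard - 1 :=
  have : Nonempty (Γ.Tangent p) := ⟨η⟩
  rankArray_eq (hM.hasRank_principal _ η)

end IsTLSWithSubseries

theorem exists_bounded_tropicalComb_eq {X : Type*} {T G : Finset (X → ℝ)} {B : ℝ} (hTG : T ⊆ G)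
    (hT : T.Nonempty) (hG : G.Nonempty) (hB₀ : 0 ≤ B) (hB : ∀ g ∈ G, ∀ x, |g x| ≤ B)
    (a : (X → ℝ) → ℝ) : ∃ (α : (X → ℝ) → ℝ) (c : ℝ), (∀ g, α g ∈ Set.Icc 0 (2 * B)) ∧
      tropicalComb G hG α = fun x => tropicalComb T hT a x + c := by
  classical
  obtain ⟨j, hj, hmin⟩ := T.exists_min_image a hT
  let α : (X → ℝ) → ℝ := fun g => if g ∈ T then min (a g - a j) (2 * B) else 2 * B
  have hα_cases (g : X → ℝ) : g ∈ T ∧ α g = a g - a j ∨ α g = 2 * B := by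
    by_cases hg : g ∈ T
    · simp only [α, if_pos hg]
      exact (min_choice (a g - a j) (2 * B)).imp (⟨hg, ·⟩) id
    · exact .inr (if_neg hg)
  have hα_le {g : X → ℝ} (hg : g ∈ T) : α g ≤ a g - a j := by
    simp only [α, if_pos hg]
    exact min_le_left _ _
  refine ⟨α, -a j, fun g => ?_, funext fun x => le_antisymm ?_ (Finset.le_inf' hG _ fun g hg => ?_)⟩
  · by_cases hg : g ∈ T
    · simp [α, if_pos hg, hmin g hg, hB₀]
    · simp [α, if_neg hg, hB₀]
  · obtain ⟨g, hg⟩ := minimizers_nonempty hT a x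
    rw [tropicalComb_eq_of_mem_minimizers hT hg]
    linarith [tropicalComb_le (a := α) (x := x) hG (hTG hg.1), hα_le hg.1]
  · rcases hα_cases g with ⟨hgT, hα⟩ | hα
    · linarith [tropicalComb_le (a := a) (x := x) hT hgT]
    · linarith [tropicalComb_le (a := a) (x := x) hT hj, abs_le.1 (hB g hg x),
        abs_le.1 (hB j (hTG hj) x)]

/-- Up to an additive constant, the coefficients of a tropical linear combination of bounded
functions can be chosen in a fixed compact interval. -/
theorem exists_tendsto_coefficients {ι : Type*} (𝒰 : Ultrafilter ι) {G : Finset (Γ.Point → ℝ)}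
    (hG : G.Nonempty) (hbdd : ∀ g ∈ G, ∃ C, ∀ q, |g q| ≤ C) {h : ι → Γ.Point → ℝ}
    (hh : ∀ i, h i ∈ tropicalSpan (G : Set (Γ.Point → ℝ))) :
    ∃ (b : (Γ.Point → ℝ) → ℝ) (α : ι → (Γ.Point → ℝ) → ℝ) (c : ι → ℝ),
      (∀ g, Filter.Tendsto (fun i => α i g) 𝒰 (𝓝 (b g))) ∧
      ∀ i, tropicalComb G hG (α i) = fun q => h i q + c i := by
  choose! C hC using hbdd
  obtain ⟨B, hB⟩ := (G.image C).bddAbove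
  have hB' : ∀ g ∈ G, ∀ q, |g q| ≤ max B 0 := fun g hg q =>
    (hC g hg q).trans ((hB (by simpa using ⟨g, hg, rfl⟩)).trans (le_max_left B 0))
  have hcoeff (i : ι) : ∃ (α : (Γ.Point → ℝ) → ℝ) (c : ℝ),
      (∀ g, α g ∈ Set.Icc 0 (2 * max B 0)) ∧ tropicalComb G hG α = fun q => h i q + c := by
    obtain ⟨T, hT, a, hTG, heq⟩ := exists_eq_tropicalComb (hh i)
    rw [heq]
    exact exists_bounded_tropicalComb_eq (Finset.coe_subset.1 hTG) hT hG (le_max_right B 0) hB' a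
  choose α c hα hcomb using hcoeff
  choose b _ hb using fun g => isCompact_Icc.ultrafilter_le_nhds (𝒰.map fun i => α i g)
    (Filter.tendsto_principal.2 (.of_forall fun i => hα i g))
  exact ⟨b, α, c, hb, hcomb⟩

theorem slope_tropicalComb_le_of_minimizers_subset {G : Finset (Γ.Point → ℝ)}
    {a b : (Γ.Point → ℝ) → ℝ} (hG : ∀ g ∈ G, IsPL g) (hne : G.Nonempty)
    (hsub : minimizers G a p ⊆ minimizers G b p) (θ : Γ.Tangent p) :
    slope (tropicalComb G hne b) θ ≤ slope (tropicalComb G hne a) θ := by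
  obtain ⟨g, hg, hslope, -⟩ := exists_slope_tropicalComb_eq hG hne a θ
  exact hslope ▸ slope_tropicalComb_le hG hne (hsub hg)

theorem finite_slopeSet_minimizers (G : Finset (Γ.Point → ℝ)) (b : (Γ.Point → ℝ) → ℝ)
    (η : Γ.Tangent p) : (slopeSet (minimizers G b p) η).Finite :=
  (G.finite_toSet.subset fun _ => mem_of_mem_minimizers).image _

theorem add_le_of_strictAntiOn_Iic {u : ℕ → ℤ} {n : ℕ} (hu : StrictAntiOn u (Set.Iic n)) :
    u n + n ≤ u 0 := by
  have hle : ∀ i ≤ n, u i + i ≤ u 0 := by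
    intro i hi
    induction i with
    | zero => simp
    | succ i ih =>
      have hlt := hu (Set.mem_Iic.2 (by omega)) (Set.mem_Iic.2 hi) i.lt_succ_self
      have := ih (by omega)
      push_cast
      omega
  exact hle n le_rfl

namespace IsSegment

variable {η : Γ.Tangent p} {D A : Γ.Divisor} {G : Finset (Γ.Point → ℝ)} {ε t : ℝ} {n : ℕ}
  {a b : (Γ.Point → ℝ) → ℝ}

theorem add_ord_le_ord [Finite E] (hseg : IsSegment η D G ε) (hG : ∀ g ∈ G, IsPL g) (ht : 0 < t)
    (hnt : n * t < ε) (hne : G.Nonempty) (hA : raySum η n t ≤ A)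
    (hcomb : DivAddGE D (tropicalComb G hne a) A)
    (hsub : ∀ i ≤ n, minimizers G a (η.ray (i * t)) ⊆ minimizers G b p) :
    n + ord (tropicalComb G hne a) p ≤ ord (tropicalComb G hne b) p := by
  obtain ⟨ψ, hψ, hanti, hψ₀⟩ := hseg.exists_strictAntiOn_slope hG ht hnt hne hA hcomb
  have hdrop := add_le_of_strictAntiOn_Iic hanti
  have hle : slope (tropicalComb G hne b) η ≤ slope (ψ n) η :=
    slope_tropicalComb_le hG hne (hsub n le_rfl (hψ n le_rfl))
  have hord := slope_sub_slope_le_ord_sub_ord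
    (slope_tropicalComb_le_of_minimizers_subset hG hne (by simpa using hsub 0 n.zero_le)) η
  omega

theorem lt_ncard_slopeSet_minimizers (hseg : IsSegment η D G ε) (hG : ∀ g ∈ G, IsPL g)
    (ht : 0 < t) (hnt : n * t < ε) (hne : G.Nonempty) (hA : raySum η n t ≤ A)
    (hcomb : DivAddGE D (tropicalComb G hne a) A)
    (hsub : ∀ i ≤ n, minimizers G a (η.ray (i * t)) ⊆ minimizers G b p) :
    n < (slopeSet (minimizers G b p) η).ncard := by
  obtain ⟨ψ, hψ, hanti, -⟩ := hseg.exists_strictAntiOn_slope hG ht hnt hne hA hcomb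
  rw [Nat.lt_iff_add_one_le, ← Set.ncard_Iic_nat n, ← hanti.injOn.ncard_image]
  refine Set.ncard_le_ncard ?_ (finite_slopeSet_minimizers G b η)
  rintro _ ⟨i, hi, rfl⟩
  exact ⟨ψ i, hsub i hi (hψ i hi), rfl⟩

end IsSegment

/-- The divisor obtained from the effective divisor `A` by replacing each of its points `p`, of
multiplicity `n`, by the points at distances `t, 2t, …, nt` along `η p`. -/
noncomputable def spread (η : ∀ p, Γ.Tangent p) (A : Γ.Divisor) (t : ℝ) : Γ.Divisor :=
  ∑ p ∈ A.support, raySum (η p) (A p).toNat t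

section Spread

variable {A : Γ.Divisor}

theorem spread_nonneg (η : ∀ p, Γ.Tangent p) (A : Γ.Divisor) (t : ℝ) : 0 ≤ spread η A t :=
  Finset.sum_nonneg fun _ _ => raySum_nonneg _ _ _

theorem deg_spread (η : ∀ p, Γ.Tangent p) (hA : 0 ≤ A) (t : ℝ) : deg (spread η A t) = deg A := by
  rw [spread, deg_sum]
  exact Finset.sum_congr rfl fun p _ => by rw [deg_raySum, Int.toNat_of_nonneg (hA p)]

theorem raySum_le_spread (η : ∀ p, Γ.Tangent p) (hp : p ∈ A.support) (t : ℝ) :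
    raySum (η p) (A p).toNat t ≤ spread η A t :=
  Finset.single_le_sum (f := fun p => raySum (η p) (A p).toNat t)
    (fun _ _ => raySum_nonneg _ _ _) hp

end Spread

namespace IsTLS

variable {D A : Γ.Divisor} {r : ℕ} {M : Set (Γ.Point → ℝ)} {G : Finset (Γ.Point → ℝ)}

/-- The coefficients `b` are a limit, as `t` tends to `0`, of the coefficients of functions in `M`
having the rank property for `spread η A t`. -/
theorem exists_divAddGE_spread [Finite E]
    (hΓ : ∀ v : V, ∃ e : E, Γ.src e = v ∨ Γ.tgt e = v)
    (hM : IsTLS D r M) (hMG : M = tropicalSpan (G : Set (Γ.Point → ℝ))) (hG : ∀ g ∈ G, IsPL g)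
    (hne : G.Nonempty) (hA : 0 ≤ A) (hdeg : deg A = r) (η : ∀ p, Γ.Tangent p)
    {ε : Γ.Point → ℝ} (hε : ∀ p, 0 < ε p) :
    ∃ t > 0, ∃ a b : (Γ.Point → ℝ) → ℝ, DivAddGE D (tropicalComb G hne a) (spread η A t) ∧
      ∀ p ∈ A.support, (A p).toNat * t < ε p ∧
        ∀ i ≤ (A p).toNat, minimizers G a ((η p).ray (i * t)) ⊆ minimizers G b p := by
  choose h hhM hdiv using fun t =>
    hM.rank (spread η A t) (spread_nonneg η A t) ((deg_spread η hA t).trans hdeg)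
  obtain ⟨b, α, c, hα, hcomb⟩ := exists_tendsto_coefficients (Ultrafilter.of (𝓝[>] (0 : ℝ))) hne
    (fun g hg => (hG g hg).exists_forall_abs_le hΓ) fun t => hMG ▸ hhM t
  have hof : (Ultrafilter.of (𝓝[>] (0 : ℝ)) : Filter ℝ) ≤ 𝓝[>] 0 := Ultrafilter.of_le _
  have hsmall : ∀ᶠ t in 𝓝[>] (0 : ℝ), ∀ p ∈ A.support, (A p).toNat * t < ε p :=
    (Filter.eventually_all_finset _).2 fun p _ =>
      ((Continuous.tendsto' (by fun_prop) _ _ (mul_zero _)).mono_left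
        nhdsWithin_le_nhds).eventually_lt_const (hε p)
  have hmin : ∀ᶠ t in (Ultrafilter.of (𝓝[>] (0 : ℝ)) : Filter ℝ), ∀ p ∈ A.support,
      ∀ i ∈ Finset.Iic (A p).toNat,
        minimizers G (α t) ((η p).ray (i * t)) ⊆ minimizers G b p :=
    (Filter.eventually_all_finset _).2 fun p _ => (Filter.eventually_all_finset _).2 fun i _ =>
      eventually_minimizers_subset fun g hg =>
        (((hG g hg).tendsto_ray_mul (η p) i).mono_left hof).add (hα g)
  obtain ⟨t, ⟨ht, hsmall⟩, hmin⟩ :=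
    (((eventually_mem_nhdsWithin.and hsmall).filter_mono hof).and hmin).exists
  refine ⟨t, ht, α t, b, ?_, fun p hp =>
    ⟨hsmall p hp, fun i hi => hmin p hp i (Finset.mem_Iic.2 hi)⟩⟩
  rw [hcomb]
  exact (hdiv t).add_const (c t)

theorem minimizers_subset_principalSeries (hM : IsTLS D r M) (hG : ∀ g ∈ G, g ∈ M)
    (hne : G.Nonempty) {b : (Γ.Point → ℝ) → ℝ} (hb : tropicalComb G hne b ∈ M) (p : Γ.Point) :
    minimizers G b p ⊆ principalSeries M p (position M p (tropicalComb G hne b)) := fun _ hg =>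
  ⟨hG _ hg.1, (hM.position_le_position_iff hb (hG _ hg.1)).2 fun _ =>
    slope_tropicalComb_le (fun g hg => hM.isPL (hG g hg)) hne hg⟩

theorem exists_divAddGE_lt_ncard_slopeSet [Finite E]
    (hΓ : ∀ v : V, ∃ e : E, Γ.src e = v ∨ Γ.tgt e = v)
    (hM : IsTLS D r M) (hA : 0 ≤ A) (hdeg : deg A = r) (η : ∀ p, Γ.Tangent p) :
    ∃ f ∈ M, DivAddGE D f A ∧
      ∀ p, A p < (slopeSet (principalSeries M p (position M p f)) (η p)).ncard := by
  obtain ⟨G, hMG, hGM⟩ := hM.fg.exists_generators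
  have hG : ∀ g ∈ G, IsPL g := fun g hg => hM.isPL (hGM g hg)
  have hne : G.Nonempty := by
    obtain ⟨f, hf, -⟩ := hM.rank A hA hdeg
    obtain ⟨T, hT, -, hTG, -⟩ := exists_eq_tropicalComb (hMG ▸ hf)
    exact hT.mono (Finset.coe_subset.1 hTG)
  choose ε hseg using fun p => exists_isSegment hG (η p) D
  obtain ⟨t, ht, a, b, hcomb, hlim⟩ :=
    hM.exists_divAddGE_spread hΓ hMG hG hne hA hdeg η fun p => (hseg p).pos
  have hb : tropicalComb G hne b ∈ M := hMG ▸ tropicalComb_mem_tropicalSpan hne b subset_rfl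
  refine ⟨_, hb, fun p => ?_, fun p => ?_⟩
  · by_cases hp : p ∈ A.support
    · have hord := (hseg p).add_ord_le_ord hG ht (hlim p hp).1 hne (raySum_le_spread η hp t) hcomb
        (hlim p hp).2
      have hspread : 0 ≤ spread η A t p := spread_nonneg η A t p
      have := hspread.trans (hcomb p)
      omega
    · rw [Finsupp.notMem_support_iff.1 hp]
      exact (hM.subset hb).2 p
  · have hlt : (A p).toNat < (slopeSet (minimizers G b p) (η p)).ncard := by
      by_cases hp : p ∈ A.support
      · exact (hseg p).lt_ncard_slopeSet_minimizers hG ht (hlim p hp).1 hne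
          (raySum_le_spread η hp t) hcomb (hlim p hp).2
      · rw [Finsupp.notMem_support_iff.1 hp, Int.toNat_zero,
          Set.ncard_pos (finite_slopeSet_minimizers G b (η p))]
        exact (minimizers_nonempty hne b p).image _
    have hle := Set.ncard_le_ncard
      (Set.image_mono (hM.minimizers_subset_principalSeries hGM hne hb p))
      (hM.finite_slopeSet_principalSeries _ (η p))
    exact (Int.self_le_toNat _).trans_lt (by exact_mod_cast hlt.trans_le hle)

end IsTLS

end MetricGraph

theorem mainTheorem3_general {V E : Type*} [Finite E] (Γ : MetricGraph V E)
    (hΓ : ∀ v : V, ∃ e : E, Γ.src e = v ∨ Γ.tgt e = v)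
    (D : Γ.Divisor) (r : ℕ) (M : Set (Γ.Point → ℝ))
    (hM : MetricGraph.IsTLSWithSubseries D r M) :
    (∀ (p : Γ.Point) (η : Γ.Tangent p), (MetricGraph.slopeSet M η).ncard = r + 1) ∧
    (∀ p : Γ.Point, MetricGraph.TotallyRankable (MetricGraph.localArray M p)) ∧
    ∀ A : Γ.Divisor, 0 ≤ A → MetricGraph.deg A = r →
      ∃ f ∈ M, MetricGraph.DivAddGE D f A ∧ MetricGraph.LocalRankProperty M f A := by
  let η (p : Γ.Point) : Γ.Tangent p := (MetricGraph.nonempty_tangent hΓ p).some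
  refine ⟨fun p => hM.ncard_slopeSet, fun p x => ⟨_, hM.hasRank_principal x (η p)⟩,
    fun A hA hdeg => ?_⟩
  obtain ⟨f, hf, hdiv, hrank⟩ := hM.exists_divAddGE_lt_ncard_slopeSet hΓ hA hdeg η
  exact ⟨f, hf, hdiv, fun p => by
    rw [hM.localRank_eq f (η p)]
    exact Int.le_sub_one_of_lt (hrank p)⟩

theorem mainTheorem3 {V E : Type*} [Finite V] [Finite E] (Γ : MetricGraph V E)
    (hΓ : ∀ v : V, ∃ e : E, Γ.src e = v ∨ Γ.tgt e = v)
    (D : Γ.Divisor) (r : ℕ) (M : Set (Γ.Point → ℝ))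
    (hM : MetricGraph.IsStronglyRecursive D r M) :
    (∀ (p : Γ.Point) (η : Γ.Tangent p), (MetricGraph.slopeSet M η).ncard = r + 1) ∧
    (∀ p : Γ.Point, MetricGraph.TotallyRankable (MetricGraph.localArray M p)) ∧
    ∀ A : Γ.Divisor, 0 ≤ A → MetricGraph.deg A = r →
      ∃ f ∈ M, MetricGraph.DivAddGE D f A ∧ MetricGraph.LocalRankProperty M f A :=
  mainTheorem3_general Γ hΓ D r M hM.isTLSWithSubseries
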